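/- Let $\mathbb F_q$ be a finite field with algebraic closure $K$, and let $\mathcal X\subset\mathbb P^n(K)$ be a geometrically irreducible projective curve defined over $\mathbb F_q$ and not contained in a hyperplane. For a nonsingular point $P\in\mathcal X$, the intersection multiplicities at $P$ of $\mathcal X$ with the hyperplanes of $\mathbb P^n(K)$ form a sequence $j_0(P)<\dots<j_n(P)$; the unique hyperplane $H_P$ whose multiplicity at $P$ is $j_n(P)$ is the osculating hyperplane at $P$. Let $(\varepsilon_0,\dots,\varepsilon_n)$ be the order sequence of $\mathcal X$, that is, the sequence $(j_0(P),\dots,j_n(P))$ for all but finitely many $P\in\mathcal X$; let $\mathcal X^\circ$ be the set of nonsingular points $P$ with $j_i(P)=\varepsilon_i$ for all $i$, let $\gamma:\mathcal X^\circ\to(\mathbb P^n(K))'$, $P\mapsto H_P$, be the strict Gauss map to the dual projective space, and let $\mathcal X'$ be the closure of its image. Let $\deg_s\gamma$ be the separable degree of $\gamma$, i.e. of the field extension $K(\mathcal X)/\gamma^*K(\mathcal X')$. Let $x_0,\dots,x_n\in\mathbb F_q(\mathcal X)$ be the coordinate functions of $\mathcal X$ and $D_t^{(m)}$ the Hasse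 derivatives with respect to a separating element $t$ of $K(\mathcal X)$. For $i\ge 1$, the $\mathbb F_{q^i}$-Frobenius order sequence of $\mathcal X$ is the lexicographically least sequence $(\nu_0,\dots,\nu_{n-1})$ of non-negative integers such that the matrix with rows $(x_0^{q^i},\dots,x_n^{q^i})$ and $(D_t^{(\nu_r)}x_0,\dots,D_t^{(\nu_r)}x_n)$, $0\le r\le n-1$, has nonzero determinant; $\mathcal X$ is $\mathbb F_{q^i}$-Frobenius nonclassical if this sequence is not $(0,1,\dots,n-1)$. Write $\Phi_{N}(a_0:\dots:a_n)=(a_0^{N}:\dots:a_n^{N})$. Let $1\le\ell<n$ and suppose that, for every $i=1,\dots,\ell$, the curve $\mathcal X$ is $\mathbb F_{q^i}$-Frobenius nonclassical and the last term of its $\mathbb F_{q^i}$-Frobenius order sequence equals $\varepsilon_n$. If $$\deg_s\gamma>\left\lceil\frac n\ell-1\right\rceil,$$ then for all but finitely many $P\in\mathcal X^\circ$ the set $$S(P)=\{\Phi_{q^k}(Q)\;:\;Q\in\gamma^{-1}(\gamma(P)),\ 0\le k\le\ell-1\}$$ lies in a linear subspace of $\mathbb P^n(K)$ of dimension $n-2$.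 -/

import Mathlib

open scoped LinearAlgebra.Projectivization

noncomputable section

/-- A geometrically irreducible (reduced, closed) subvariety of `ℙⁿ` over the algebraically closed
field `K`, defined over the subfield `k` and not contained in a hyperplane, given by its
homogeneous prime ideal. -/
structure ProjVariety (k K : Type*) [Field k] [Field K] [Algebra k K] (n : ℕ) where
  /-- the homogeneous vanishing ideal -/
  ideal : Ideal (MvPolynomial (Fin (n + 1)) K)
  isPrime : ideal.IsPrime
  homogeneous : ∀ f ∈ ideal, ∀ d : ℕ, MvPolynomial.homogeneousComponent d f ∈ ideal
  definedOver : ∃ s : Set (MvPolynomial (Fin (n + 1)) k),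
    ideal = Ideal.span (MvPolynomial.map (algebraMap k K) '' s)
  nondegenerate : ∀ a : Fin (n + 1) → K,
    (∑ i, MvPolynomial.C (a i) * MvPolynomial.X i) ∈ ideal → a = 0

/-- The Frobenius map `(x₀ : … : xₙ) ↦ (x₀ ^ N : … : xₙ ^ N)` of projective space. -/
def frobeniusMap {K : Type*} [Field K] {n : ℕ} (N : ℕ) (P : ℙ K (Fin (n + 1) → K)) :
    ℙ K (Fin (n + 1) → K) :=
  Projectivization.mk K (fun i => P.rep i ^ N) (fun h => P.rep_nonzero
    (funext fun i => eq_zero_of_pow_eq_zero (congrFun h i)))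

namespace ProjVariety

variable {k K : Type*} [Field k] [Field K] [Algebra k K] {n : ℕ} (X : ProjVariety k K n)

instance : X.ideal.IsPrime := X.isPrime

/-- The homogeneous coordinate ring. -/
abbrev CoordRing : Type _ := MvPolynomial (Fin (n + 1)) K ⧸ X.ideal

/-- The fraction field of the homogeneous coordinate ring (it contains the function field). -/
abbrev Frac : Type _ := FractionRing X.CoordRing

/-- The class of a polynomial in the fraction field of the homogeneous coordinate ring. -/
def cls (f : MvPolynomial (Fin (n + 1)) K) : X.Frac :=
  algebraMap X.CoordRing X.Frac (Ideal.Quotient.mk X.ideal f)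

/-- The function field `K(X)`, generated over `K` by the quotients of the coordinates. -/
def functionField : IntermediateField K X.Frac :=
  IntermediateField.adjoin K
    (Set.range fun ij : Fin (n + 1) × Fin (n + 1) =>
      X.cls (MvPolynomial.X ij.1) / X.cls (MvPolynomial.X ij.2))

/-- The variety is a curve: its function field has transcendence degree one. -/
def IsCurve : Prop := Algebra.trdeg K X.functionField = 1

/-- The coordinate functions `x₀/x₀, …, xₙ/x₀` of `X` (`x₀ ≠ 0` on `X`, as `X` is
nondegenerate). -/
def coordFun (i : Fin (n + 1)) : X.functionField :=
  ⟨X.cls (MvPolynomial.X i) / X.cls (MvPolynomial.X 0),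
    IntermediateField.subset_adjoin K _ ⟨(i, 0), rfl⟩⟩

/-- The set of points of `X`. -/
def points : Set (ℙ K (Fin (n + 1) → K)) :=
  {P | ∀ f ∈ X.ideal, MvPolynomial.eval P.rep f = 0}

/-- The rational function `z` is regular at `P` with value `c`. -/
def HasValue (P : ℙ K (Fin (n + 1) → K)) (z : X.functionField) (c : K) : Prop :=
  ∃ (d : ℕ) (f g : MvPolynomial (Fin (n + 1)) K), f.IsHomogeneous d ∧ g.IsHomogeneous d ∧
    MvPolynomial.eval P.rep g ≠ 0 ∧ (z : X.Frac) * X.cls g = X.cls f ∧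
    c * MvPolynomial.eval P.rep g = MvPolynomial.eval P.rep f

/-- The local ring of `X` at `P`: the rational functions that are regular at `P`. -/
def localRing (P : ℙ K (Fin (n + 1) → K)) : Subalgebra K X.functionField where
  carrier := {z | ∃ c, X.HasValue P z c}
  mul_mem' := by
    rintro z w ⟨c, d, f, g, hf, hg, h0, h1, h2⟩ ⟨c', d', f', g', hf', hg', h0', h1', h2'⟩
    refine ⟨c * c', d + d', f * f', g * g', hf.mul hf', hg.mul hg', ?_, ?_, ?_⟩
    · simpa using ⟨h0, h0'⟩
    · simp only [cls, map_mul, MulMemClass.coe_mul] at *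
      rw [← h1, ← h1']; ring
    · simp only [map_mul]
      rw [← h2, ← h2']; ring
  add_mem' := by
    rintro z w ⟨c, d, f, g, hf, hg, h0, h1, h2⟩ ⟨c', d', f', g', hf', hg', h0', h1', h2'⟩
    refine ⟨c + c', d + d', f * g' + g * f', g * g', (hf.mul hg').add (hg.mul hf'),
      hg.mul hg', ?_, ?_, ?_⟩
    · simpa using ⟨h0, h0'⟩
    · simp only [cls, map_mul, map_add, AddMemClass.coe_add] at *
      rw [← h1, ← h1']; ring
    · simp only [map_mul, map_add]
      rw [← h2, ← h2']; ring
  algebraMap_mem' := by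
    intro c
    refine ⟨c, 0, MvPolynomial.C c, 1, MvPolynomial.isHomogeneous_C _ _,
      MvPolynomial.isHomogeneous_one _ _, by simp, ?_, by simp⟩
    simp only [cls, map_one, mul_one]
    rfl

/-- `P` is a nonsingular point of the curve `X`. -/
def IsNonsingularAt (P : ℙ K (Fin (n + 1) → K)) : Prop :=
  P ∈ X.points ∧ IsDiscreteValuationRing (X.localRing P)

/-- The intersection multiplicity at the nonsingular point `P` of `X` with the hyperplane
`H : a₀ X₀ + ⋯ + aₙ Xₙ = 0`, seen as the point `(a₀ : … : aₙ)` of the dual projective space,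
is `m`: the valuation at `P` of `(∑ aᵢ xᵢ) / xⱼ`, where `xⱼ(P) ≠ 0`, is `m`. -/
def HasIntersectionMult (P H : ℙ K (Fin (n + 1) → K)) (m : ℕ) : Prop :=
  ∃ (j : Fin (n + 1)) (z ϖ : X.localRing P), P.rep j ≠ 0 ∧
    ((z : X.functionField) : X.Frac) * X.cls (MvPolynomial.X j) =
      X.cls (∑ i, MvPolynomial.C (H.rep i) * MvPolynomial.X i) ∧
    Irreducible ϖ ∧ Associated z (ϖ ^ m)

/-- All intersection multiplicities of `X` with hyperplanes at `P`. -/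
def orderSet (P : ℙ K (Fin (n + 1) → K)) : Set ℕ := {m | ∃ H, X.HasIntersectionMult P H m}

/-- `j` is the order sequence `(j₀(P), …, jₙ(P))` of the nonsingular point `P`. -/
def IsOrderSeqAt (P : ℙ K (Fin (n + 1) → K)) (j : Fin (n + 1) → ℕ) : Prop :=
  StrictMono j ∧ Set.range j = X.orderSet P

/-- The set `X°` of the nonsingular points of `X` with order sequence `ε`. -/
def openLocus (ε : Fin (n + 1) → ℕ) : Set (ℙ K (Fin (n + 1) → K)) :=
  {P | X.IsNonsingularAt P ∧ X.IsOrderSeqAt P ε}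

/-- `ε` is the order sequence of the curve `X`: that of all but finitely many points. -/
def IsOrderSeq (ε : Fin (n + 1) → ℕ) : Prop := (X.points \ X.openLocus ε).Finite

/-- `H` is the osculating hyperplane at `P`: its intersection multiplicity with `X` at `P` is
the last term of the order sequence of `P`. -/
def IsOsculating (P H : ℙ K (Fin (n + 1) → K)) : Prop :=
  ∃ m, IsGreatest (X.orderSet P) m ∧ X.HasIntersectionMult P H m

/-- The strict Gauss map, sending a nonsingular point `P` to its osculating hyperplane, a point
of the dual projective space. -/
def gaussMap (P : ℙ K (Fin (n + 1) → K)) : ℙ K (Fin (n + 1) → K) :=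
  Classical.epsilon (X.IsOsculating P)

/-- The subfield `γ^*(K(X'))` of `K(X)`, where `X'` is the strict dual curve, the closure of the
image of `γ`: the functions `P ↦ A(γ(P)) / B(γ(P))`, where `A`, `B` are forms of the same degree
and `B` does not vanish identically on `X'`. -/
def gaussField (ε : Fin (n + 1) → ℕ) : IntermediateField K X.functionField :=
  IntermediateField.adjoin K {z | ∃ (d : ℕ) (A B : MvPolynomial (Fin (n + 1)) K),
    A.IsHomogeneous d ∧ B.IsHomogeneous d ∧
    {P | P ∈ X.openLocus ε ∧ ¬ (MvPolynomial.eval (X.gaussMap P).rep B ≠ 0 ∧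
      X.HasValue P z (MvPolynomial.eval (X.gaussMap P).rep A /
        MvPolynomial.eval (X.gaussMap P).rep B))}.Finite}

/-- The separable degree of `γ`, i.e. that of the extension `K(X) / γ^*(K(X'))`. -/
def gaussSepDegree (ε : Fin (n + 1) → ℕ) : ℕ :=
  Field.finSepDegree (X.gaussField ε) X.functionField

/-- `t` is a separating element of `K(X)`. -/
def IsSeparating (t : X.functionField) : Prop :=
  Algebra.IsSeparable (IntermediateField.adjoin K {t}) X.functionField

/-- `D m`, `m = 0, 1, 2, …`, are the Hasse derivatives on `K(X)` with respect to `t` (if `t` is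
separating, they are the only family with these properties). -/
structure IsHasseDeriv (t : X.functionField)
    (D : ℕ → X.functionField →ₗ[K] X.functionField) : Prop where
  zero : D 0 = LinearMap.id
  leibniz : ∀ m f g, D m (f * g) = ∑ ij ∈ Finset.HasAntidiagonal.antidiagonal m, D ij.1 f * D ij.2 g
  one_self : D 1 t = 1
  self : ∀ m, 2 ≤ m → D m t = 0

/-- The matrix with rows `(x₀ ^ N, …, xₙ ^ N)` and `(D^(μᵢ) x₀, …, D^(μᵢ) xₙ)`, `i < n`. -/
def frobeniusMatrix (D : ℕ → X.functionField →ₗ[K] X.functionField) (N : ℕ) (μ : Fin n → ℕ) :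
    Matrix (Fin (n + 1)) (Fin (n + 1)) X.functionField :=
  Matrix.of (Fin.cons (fun j => X.coordFun j ^ N) (fun i j => D (μ i) (X.coordFun j)))

/-- `ν` is the `𝔽_N`-Frobenius order sequence of the curve `X`: the least sequence in the
lexicographic order for which the above matrix has nonzero determinant. -/
def IsFrobeniusOrderSeq (N : ℕ) (ν : Fin n → ℕ) : Prop :=
  ∃ (t : X.functionField) (D : ℕ → X.functionField →ₗ[K] X.functionField),
    X.IsSeparating t ∧ X.IsHasseDeriv t D ∧ (X.frobeniusMatrix D N ν).det ≠ 0 ∧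
    ∀ μ : Fin n → ℕ, (X.frobeniusMatrix D N μ).det ≠ 0 → toLex ν ≤ toLex μ

/-- The set `S(P)` of the points `Φ_{q ^ r}(Q)` with `Q ∈ γ⁻¹(γ(P))` and `0 ≤ r ≤ ℓ - 1`. -/
def conjSet (ε : Fin (n + 1) → ℕ) (q ℓ : ℕ) (P : ℙ K (Fin (n + 1) → K)) :
    Set (ℙ K (Fin (n + 1) → K)) :=
  {R | ∃ Q ∈ X.openLocus ε, X.gaussMap Q = X.gaussMap P ∧ ∃ r < ℓ, R = frobeniusMap (q ^ r) Q}

end ProjVariety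

/-- The set `S` of points of `ℙⁿ` lies in a linear subspace of (projective) dimension `d`. -/
def LiesInLinearSubspace {K : Type*} [Field K] {n : ℕ} (S : Set (ℙ K (Fin (n + 1) → K)))
    (d : ℕ) : Prop :=
  ∃ W : Submodule K (Fin (n + 1) → K), Module.finrank K W = d + 1 ∧ ∀ R ∈ S, R.submodule ≤ W

end

open scoped LinearAlgebra.Projectivization

noncomputable section

namespace ProjVariety

variable {k K : Type*} [Field k] [Field K] [Algebra k K] {n : ℕ} (X : ProjVariety k K n)

/-! ### Values of rational functions -/

/-! For general `P`, the osculating hyperplane `H = γ(P)` contains `Φ_{q^i}(P)` for `0 ≤ i ≤ ℓ`. The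
case `i = 0` is tangency (`gaussMap_incident`). For `i ≥ 1`, expand the Frobenius determinant along
its last derivative row, of order `ε_n`. Lexicographic minimality makes the determinant vanish once
that order is lowered, so the cofactors `a_j` of the row satisfy `∑ a_j D^m x_j = 0` for `m < ε_n`,
besides `∑ a_j x_j^{q^i} = 0`. At a general `P`, the hyperplane with coefficients `a_j(P)` thus has
contact of order at least `ε_n` with the curve, so it is `H`, and it contains `Φ_{q^i}(P)`
(`eventually_frobenius_incident`).

The fibres of `γ` are finite (`finite_gaussMap_fiber`), so the whole fibres through the exceptional
points can be discarded. Then `S(P)` and `Φ_q(S(P))` both lie in `H`. If `H'` has as coefficients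
the `q`-th roots of those of `H`, then `S(P) ⊆ H ∩ H'`, which has dimension `n - 2` unless `H` is
`𝔽_q`-rational. There are finitely many rational hyperplanes, hence finitely many such `P`. -/

lemma cls_eq_zero_iff (f : MvPolynomial (Fin (n + 1)) K) : X.cls f = 0 ↔ f ∈ X.ideal := by
  rw [cls, map_eq_zero_iff _ (IsFractionRing.injective X.CoordRing X.Frac),
    Ideal.Quotient.eq_zero_iff_mem]

lemma cls_add (f g : MvPolynomial (Fin (n + 1)) K) : X.cls (f + g) = X.cls f + X.cls g := by
  simp [cls]

lemma cls_sub (f g : MvPolynomial (Fin (n + 1)) K) : X.cls (f - g) = X.cls f - X.cls g := by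
  simp [cls]

lemma cls_mul (f g : MvPolynomial (Fin (n + 1)) K) : X.cls (f * g) = X.cls f * X.cls g := by
  simp [cls]

lemma cls_eq_aeval (f : MvPolynomial (Fin (n + 1)) K) :
    X.cls f = MvPolynomial.aeval (fun i => X.cls (MvPolynomial.X i)) f := by
  let φ : MvPolynomial (Fin (n + 1)) K →ₐ[K] X.Frac :=
    (IsScalarTower.toAlgHom K X.CoordRing X.Frac).comp (Ideal.Quotient.mkₐ K X.ideal)
  have h : φ = MvPolynomial.aeval (fun i => X.cls (MvPolynomial.X i)) := by
    ext i
    rw [MvPolynomial.aeval_X]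
    rfl
  exact DFunLike.congr_fun h f

lemma cls_linearForm_ne_zero {a : Fin (n + 1) → K} (ha : a ≠ 0) :
    X.cls (∑ i, MvPolynomial.C (a i) * MvPolynomial.X i) ≠ 0 := fun h =>
  ha (X.nondegenerate a ((X.cls_eq_zero_iff _).1 h))

lemma cls_X_ne_zero (j : Fin (n + 1)) : X.cls (MvPolynomial.X j) ≠ 0 := by
  have h := X.cls_linearForm_ne_zero (a := Pi.single j 1) (by simp)
  simpa [Pi.single_apply] using h

lemma cls_ne_zero_of_eval_ne_zero {P : ℙ K (Fin (n + 1) → K)} (hP : P ∈ X.points)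
    {g : MvPolynomial (Fin (n + 1)) K} (hg : MvPolynomial.eval P.rep g ≠ 0) : X.cls g ≠ 0 :=
  fun h => hg (hP g ((X.cls_eq_zero_iff g).1 h))

variable {X} in
lemma HasValue.unique {P : ℙ K (Fin (n + 1) → K)} (hP : P ∈ X.points) {z : X.functionField}
    {c c' : K} (h : X.HasValue P z c) (h' : X.HasValue P z c') : c = c' := by
  obtain ⟨d, f, g, -, -, h0, h1, h2⟩ := h
  obtain ⟨d', f', g', -, -, h0', h1', h2'⟩ := h'
  have hmem : f * g' - f' * g ∈ X.ideal := by
    rw [← X.cls_eq_zero_iff, cls_sub, cls_mul, cls_mul, ← h1, ← h1']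
    ring
  have hev := hP _ hmem
  rw [map_sub, map_mul, map_mul, ← h2, ← h2', sub_eq_zero] at hev
  have : c * (MvPolynomial.eval P.rep g * MvPolynomial.eval P.rep g') =
      c' * (MvPolynomial.eval P.rep g * MvPolynomial.eval P.rep g') := by
    linear_combination hev
  exact mul_right_cancel₀ (mul_ne_zero h0 h0') this

variable {X} in
lemma HasValue.add {P : ℙ K (Fin (n + 1) → K)} {z w : X.functionField} {c c' : K}
    (h : X.HasValue P z c) (h' : X.HasValue P w c') : X.HasValue P (z + w) (c + c') := by
  obtain ⟨d, f, g, hf, hg, h0, h1, h2⟩ := h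
  obtain ⟨d', f', g', hf', hg', h0', h1', h2'⟩ := h'
  refine ⟨d + d', f * g' + g * f', g * g', (hf.mul hg').add (hg.mul hf'), hg.mul hg', ?_, ?_, ?_⟩
  · simpa using ⟨h0, h0'⟩
  · rw [cls_add, cls_mul, cls_mul, cls_mul, ← h1, ← h1', AddMemClass.coe_add]
    ring
  · simp only [map_mul, map_add]
    rw [← h2, ← h2']
    ring

variable {X} in
lemma HasValue.mul {P : ℙ K (Fin (n + 1) → K)} {z w : X.functionField} {c c' : K}
    (h : X.HasValue P z c) (h' : X.HasValue P w c') : X.HasValue P (z * w) (c * c') := by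
  obtain ⟨d, f, g, hf, hg, h0, h1, h2⟩ := h
  obtain ⟨d', f', g', hf', hg', h0', h1', h2'⟩ := h'
  refine ⟨d + d', f * f', g * g', hf.mul hf', hg.mul hg', ?_, ?_, ?_⟩
  · simpa using ⟨h0, h0'⟩
  · rw [cls_mul, cls_mul, ← h1, ← h1', MulMemClass.coe_mul]
    ring
  · simp only [map_mul]
    rw [← h2, ← h2']
    ring

variable {X} in
lemma HasValue.inv {P : ℙ K (Fin (n + 1) → K)} (hP : P ∈ X.points) {z : X.functionField} {c : K}
    (h : X.HasValue P z c) (hc : c ≠ 0) : X.HasValue P z⁻¹ c⁻¹ := by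
  obtain ⟨d, f, g, hf, hg, h0, h1, h2⟩ := h
  have hf0 : MvPolynomial.eval P.rep f ≠ 0 := h2 ▸ mul_ne_zero hc h0
  have hz : (z : X.Frac) ≠ 0 := by
    intro hz
    rw [hz, zero_mul] at h1
    exact X.cls_ne_zero_of_eval_ne_zero hP hf0 h1.symm
  refine ⟨d, g, f, hg, hf, hf0, ?_, ?_⟩
  · rw [← h1, IntermediateField.coe_inv, inv_mul_cancel_left₀ hz]
  · rw [← h2, inv_mul_cancel_left₀ hc]

lemma hasValue_algebraMap (P : ℙ K (Fin (n + 1) → K)) (c : K) :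
    X.HasValue P (algebraMap K X.functionField c) c := by
  refine ⟨0, MvPolynomial.C c, 1, MvPolynomial.isHomogeneous_C _ _,
    MvPolynomial.isHomogeneous_one _ _, by simp, ?_, by simp⟩
  simp only [cls, map_one, mul_one]
  rfl

/-- The rational function `xᵢ / xⱼ`. -/
def ratio (i j : Fin (n + 1)) : X.functionField :=
  ⟨X.cls (MvPolynomial.X i) / X.cls (MvPolynomial.X j),
    IntermediateField.subset_adjoin K _ ⟨(i, j), rfl⟩⟩

lemma ratio_ne_zero (i j : Fin (n + 1)) : X.ratio i j ≠ 0 := fun h =>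
  div_ne_zero (X.cls_X_ne_zero i) (X.cls_X_ne_zero j) (congrArg Subtype.val h)

lemma hasValue_ratio {P : ℙ K (Fin (n + 1) → K)} (i : Fin (n + 1)) {j : Fin (n + 1)}
    (hj : P.rep j ≠ 0) : X.HasValue P (X.ratio i j) (P.rep i / P.rep j) := by
  refine ⟨1, MvPolynomial.X i, MvPolynomial.X j, MvPolynomial.isHomogeneous_X _ _,
    MvPolynomial.isHomogeneous_X _ _, by simpa using hj, ?_, ?_⟩
  · exact div_mul_cancel₀ _ (X.cls_X_ne_zero j)
  · simp [div_mul_cancel₀ _ hj]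

lemma hasValue_coordFun {P : ℙ K (Fin (n + 1) → K)} (h0 : P.rep 0 ≠ 0) (i : Fin (n + 1)) :
    X.HasValue P (X.coordFun i) (P.rep i / P.rep 0) :=
  X.hasValue_ratio i h0

/-- Evaluation at the point `P` of `X`, as a homomorphism from the local ring to `K`. -/
def evalAt {P : ℙ K (Fin (n + 1) → K)} (hP : P ∈ X.points) : X.localRing P →ₐ[K] K where
  toFun z := z.2.choose
  map_one' := HasValue.unique hP (Exists.choose_spec _)
    (by simpa using X.hasValue_algebraMap P 1)
  map_mul' z w := HasValue.unique hP (Exists.choose_spec _)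
    (HasValue.mul (Exists.choose_spec _) (Exists.choose_spec _))
  map_zero' := HasValue.unique hP (Exists.choose_spec _)
    (by simpa using X.hasValue_algebraMap P 0)
  map_add' z w := HasValue.unique hP (Exists.choose_spec _)
    (HasValue.add (Exists.choose_spec _) (Exists.choose_spec _))
  commutes' c := HasValue.unique hP (Exists.choose_spec _) (X.hasValue_algebraMap P c)

lemma hasValue_evalAt {P : ℙ K (Fin (n + 1) → K)} (hP : P ∈ X.points) (z : X.localRing P) :
    X.HasValue P z (X.evalAt hP z) :=
  z.2.choose_spec

variable {X} in
lemma HasValue.evalAt_eq {P : ℙ K (Fin (n + 1) → K)} (hP : P ∈ X.points) {z : X.localRing P}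
    {c : K} (h : X.HasValue P z c) : X.evalAt hP z = c :=
  HasValue.unique hP (X.hasValue_evalAt hP z) h

/-- The inverse of `f / g` is `g / f`, regular where `f` does not vanish. Hence evaluation at `P`
detects the maximal ideal. -/
lemma isUnit_iff_evalAt_ne_zero {P : ℙ K (Fin (n + 1) → K)} (hP : P ∈ X.points)
    (z : X.localRing P) : IsUnit z ↔ X.evalAt hP z ≠ 0 := by
  refine ⟨fun h => (h.map (X.evalAt hP)).ne_zero, fun h => ?_⟩
  have hinv := (X.hasValue_evalAt hP z).inv hP h
  refine IsUnit.of_mul_eq_one (⟨(z : X.functionField)⁻¹, _, hinv⟩ : X.localRing P) ?_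
  have hz : (z : X.functionField) ≠ 0 := fun hz => h (by
    rw [show z = 0 from Subtype.ext hz, map_zero])
  exact Subtype.ext (mul_inv_cancel₀ hz)

/-! ### Finiteness of zeros and poles -/

/-- In transcendence degree one, `z` and `y` are algebraically dependent. The relation is written in
powers of `z` over `K[y]`, so that `z` can be factored out. -/
lemma exists_bivariate_relation (hX : X.IsCurve) (z y : X.functionField) :
    ∃ G : Polynomial (Polynomial K), G ≠ 0 ∧
      G.eval₂ (Polynomial.aeval y : Polynomial K →ₐ[K] X.functionField).toRingHom z = 0 := by
  have hdep : ¬ AlgebraicIndependent K ![z, y] := by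
    intro h
    have := h.lift_cardinalMk_le_trdeg
    rw [show Algebra.trdeg K X.functionField = 1 from hX] at this
    norm_num at this
  rw [algebraicIndependent_iff] at hdep
  push Not at hdep
  obtain ⟨F, hF, hF0⟩ := hdep
  let e : MvPolynomial (Fin 1) K ≃ₐ[K] Polynomial K := MvPolynomial.uniqueAlgEquiv K (Fin 1)
  refine ⟨(MvPolynomial.finSuccEquiv K 1 F).map e.toRingEquiv.toRingHom, ?_, ?_⟩
  · rw [Ne, Polynomial.map_eq_zero_iff e.injective]
    simpa using hF0
  · rw [← hF, Polynomial.eval₂_map]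
    let φ : MvPolynomial (Fin 2) K →+* X.functionField :=
      (Polynomial.eval₂RingHom ((Polynomial.aeval y : Polynomial K →ₐ[K] _).toRingHom.comp
        e.toRingEquiv.toRingHom) z).comp (MvPolynomial.finSuccEquiv K 1).toRingEquiv.toRingHom
    have hφ : φ = (MvPolynomial.aeval ![z, y] : MvPolynomial (Fin 2) K →ₐ[K] _).toRingHom := by
      refine MvPolynomial.ringHom_ext (fun c => ?_) (fun i => ?_)
      · simp [φ, MvPolynomial.finSuccEquiv_apply, e]
      · refine Fin.cases ?_ (fun i => ?_) i
        · simp [φ, MvPolynomial.finSuccEquiv_X_zero]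
        · simp [φ, MvPolynomial.finSuccEquiv_X_succ, e]
    exact DFunLike.congr_fun hφ F

/-- At the zeros of a nonzero rational function, another one takes finitely many values. -/
lemma exists_polynomial_eval_eq_zero (hX : X.IsCurve) {z : X.functionField} (hz : z ≠ 0)
    (y : X.functionField) : ∃ p : Polynomial K, p ≠ 0 ∧ ∀ P ∈ X.points, ∀ c,
      X.HasValue P z 0 → X.HasValue P y c → p.eval c = 0 := by
  obtain ⟨G, hG0, hG⟩ := X.exists_bivariate_relation hX z y
  -- After division by the largest power of `z`, the constant term is a nonzero polynomial in `y`;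
  -- it must vanish wherever `z` does.
  obtain ⟨G', hG', hdvd⟩ := G.exists_eq_pow_rootMultiplicity_mul_and_not_dvd hG0 0
  rw [map_zero, sub_zero] at hG' hdvd
  rw [Polynomial.X_dvd_iff] at hdvd
  rw [hG', Polynomial.eval₂_mul, Polynomial.eval₂_pow, Polynomial.eval₂_X] at hG
  have hrel := (mul_eq_zero.1 hG).resolve_left (pow_ne_zero _ hz)
  refine ⟨G'.coeff 0, hdvd, fun P hP c hzP hyP => ?_⟩
  let z' : X.localRing P := ⟨z, _, hzP⟩
  let y' : X.localRing P := ⟨y, _, hyP⟩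
  have hrel' : G'.eval₂ (Polynomial.aeval y' : Polynomial K →ₐ[K] X.localRing P).toRingHom z'
      = 0 := by
    apply Subtype.val_injective
    refine Eq.trans ?_ hrel
    refine (Polynomial.hom_eval₂ G' _ (X.localRing P).val.toRingHom z').trans ?_
    congr 1
    ext p
    · simp
    · simp [y']
  have hev := congrArg (X.evalAt hP).toRingHom hrel'
  rw [Polynomial.hom_eval₂, map_zero] at hev
  have hz0 : (X.evalAt hP).toRingHom z' = 0 := HasValue.evalAt_eq hP hzP
  rw [hz0, Polynomial.eval₂_at_zero] at hev
  have hy0 : X.evalAt hP y' = c := HasValue.evalAt_eq hP hyP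
  have hcomp : X.evalAt hP (Polynomial.aeval y' (G'.coeff 0)) = 0 := hev
  rwa [← Polynomial.aeval_algHom_apply, hy0, Polynomial.coe_aeval_eq_eval] at hcomp

lemma eq_of_rep_div_eq {P Q : ℙ K (Fin (n + 1) → K)} {j : Fin (n + 1)} (hP : P.rep j ≠ 0)
    (hQ : Q.rep j ≠ 0) (h : ∀ i, P.rep i / P.rep j = Q.rep i / Q.rep j) : P = Q := by
  rw [← P.mk_rep, ← Q.mk_rep, Projectivization.mk_eq_mk_iff']
  refine ⟨P.rep j / Q.rep j, funext fun i => ?_⟩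
  have := h i
  rw [div_eq_div_iff hP hQ] at this
  rw [Pi.smul_apply, smul_eq_mul]
  field_simp
  linear_combination -this

/-- On each chart `x_j ≠ 0`, every ratio `x_i / x_j` takes finitely many values at the zeros of `z`,
and these ratios determine the point. -/
lemma finite_zeros (hX : X.IsCurve) {z : X.functionField} (hz : z ≠ 0) :
    {P | P ∈ X.points ∧ X.HasValue P z 0}.Finite := by
  choose p hp0 hp using X.exists_polynomial_eval_eq_zero hX hz
  have hsub : {P | P ∈ X.points ∧ X.HasValue P z 0} ⊆
      ⋃ j : Fin (n + 1), {P | (P ∈ X.points ∧ X.HasValue P z 0) ∧ P.rep j ≠ 0} := by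
    intro P hP
    obtain ⟨j, hj⟩ := Function.ne_iff.1 P.rep_nonzero
    exact Set.mem_iUnion.2 ⟨j, hP, hj⟩
  refine (Set.finite_iUnion fun j => ?_).subset hsub
  refine Set.Finite.of_injOn
    (t := Set.pi Set.univ fun i => {c | (p (X.ratio i j)).eval c = 0})
    (f := fun P i => P.rep i / P.rep j) ?_ ?_ (Set.Finite.pi fun i => ?_)
  · rintro P ⟨⟨hP, hzP⟩, hj⟩ i -
    exact hp _ P hP _ hzP (X.hasValue_ratio i hj)
  · rintro P ⟨-, hj⟩ Q ⟨-, hj'⟩ h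
    exact eq_of_rep_div_eq hj hj' (congrFun h)
  · exact Polynomial.finite_setOfPred_isRoot (hp0 _)

lemma finite_rep_eq_zero (hX : X.IsCurve) (j : Fin (n + 1)) :
    {P | P ∈ X.points ∧ P.rep j = 0}.Finite := by
  refine (Set.finite_iUnion fun i => X.finite_zeros hX (X.ratio_ne_zero j i)).subset ?_
  rintro P ⟨hP, hj⟩
  obtain ⟨i, hi⟩ := Function.ne_iff.1 P.rep_nonzero
  refine Set.mem_iUnion.2 ⟨i, hP, ?_⟩
  simpa [hj] using X.hasValue_ratio (P := P) j hi

/-- Coordinate ratios have poles only where the denominator vanishes; sums and products add no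
poles, and an inverse adds at most the zeros. -/
lemma finite_poles (hX : X.IsCurve) (z : X.functionField) :
    {P | P ∈ X.points ∧ z ∉ X.localRing P}.Finite := by
  obtain ⟨z, hz⟩ := z
  induction hz using IntermediateField.adjoin_induction with
  | mem x hx =>
    obtain ⟨⟨i, j⟩, rfl⟩ := hx
    refine (X.finite_rep_eq_zero hX j).subset ?_
    rintro P ⟨hP, h⟩
    exact ⟨hP, by_contra fun hj => h ⟨_, X.hasValue_ratio i hj⟩⟩
  | algebraMap c =>
    convert Set.finite_empty
    refine Set.eq_empty_iff_forall_notMem.2 fun P hP => hP.2 ?_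
    exact (X.localRing P).algebraMap_mem c
  | add x y hx hy h1 h2 =>
    refine (h1.union h2).subset ?_
    rintro P ⟨hP, h⟩
    by_contra hcon
    simp only [Set.mem_union, Set.mem_ofPred_eq, not_or, not_and, not_not] at hcon
    exact h ((X.localRing P).add_mem (hcon.1 hP) (hcon.2 hP))
  | mul x y hx hy h1 h2 =>
    refine (h1.union h2).subset ?_
    rintro P ⟨hP, h⟩
    by_contra hcon
    simp only [Set.mem_union, Set.mem_ofPred_eq, not_or, not_and, not_not] at hcon
    exact h ((X.localRing P).mul_mem (hcon.1 hP) (hcon.2 hP))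
  | inv x hx h1 =>
    by_cases h0 : x = 0
    · subst h0
      simpa only [inv_zero] using h1
    · have hx0 : (⟨x, hx⟩ : X.functionField) ≠ 0 := fun h => h0 (congrArg Subtype.val h)
      refine (h1.union (X.finite_zeros hX hx0)).subset ?_
      rintro P ⟨hP, h⟩
      by_contra hcon
      simp only [Set.mem_union, Set.mem_ofPred_eq, not_or, not_and, not_not] at hcon
      obtain ⟨c, hc⟩ := hcon.1 hP
      refine h ⟨c⁻¹, hc.inv hP ?_⟩
      rintro rfl
      exact hcon.2 hP hc

end ProjVariety

lemma MvPolynomial.IsHomogeneous.aeval_mul_left {σ R S : Type*} [Fintype σ] [CommSemiring R]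
    [CommSemiring S] [Algebra R S] {f : MvPolynomial σ R} {d : ℕ} (hf : f.IsHomogeneous d) (c : S)
    (v : σ → S) : MvPolynomial.aeval (fun i => c * v i) f = c ^ d * MvPolynomial.aeval v f := by
  simp only [MvPolynomial.aeval_def, MvPolynomial.eval₂_eq', Finset.mul_sum]
  refine Finset.sum_congr rfl fun m hm => ?_
  have hdeg : ∑ i, m i = d := by
    have := hf.degree_eq_sum_deg_support hm
    rw [this]
    exact (Finset.sum_subset (Finset.subset_univ _) fun i _ hi => by simpa using hi).symm
  simp only [mul_pow, Finset.prod_mul_distrib, Finset.prod_pow_eq_pow_sum, hdeg]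
  ring

namespace ProjVariety

variable {k K : Type*} [Field k] [Field K] [Algebra k K] {n : ℕ} (X : ProjVariety k K n)

/-! ### Linear forms and intersection multiplicities -/

lemma cls_eq_pow_mul_aeval_coordFun {f : MvPolynomial (Fin (n + 1)) K} {d : ℕ}
    (hf : f.IsHomogeneous d) :
    X.cls f = X.cls (MvPolynomial.X 0) ^ d *
      ((MvPolynomial.aeval X.coordFun f : X.functionField) : X.Frac) := by
  have h : ((MvPolynomial.aeval X.coordFun f : X.functionField) : X.Frac) =
      MvPolynomial.aeval (fun i => (X.coordFun i : X.Frac)) f :=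
    MvPolynomial.comp_aeval_apply _ X.functionField.val f
  rw [h, ← hf.aeval_mul_left, cls_eq_aeval]
  congr 2
  funext i
  exact (mul_div_cancel₀ _ (X.cls_X_ne_zero 0)).symm

/-- The rational function `(∑ aᵢ xᵢ) / x₀`, as an element of the local ring at `P`. -/
def linearFormAt {P : ℙ K (Fin (n + 1) → K)} (h0 : P.rep 0 ≠ 0) :
    (Fin (n + 1) → K) →ₗ[K] X.localRing P :=
  Fintype.linearCombination K fun i => ⟨X.coordFun i, _, X.hasValue_coordFun h0 i⟩

lemma coe_linearFormAt {P : ℙ K (Fin (n + 1) → K)} (h0 : P.rep 0 ≠ 0) (a : Fin (n + 1) → K) :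
    (X.linearFormAt h0 a : X.functionField) = ∑ i, a i • X.coordFun i := by
  simp [linearFormAt, Fintype.linearCombination_apply]

lemma linearFormAt_mul_cls {P : ℙ K (Fin (n + 1) → K)} (h0 : P.rep 0 ≠ 0) (a : Fin (n + 1) → K) :
    ((X.linearFormAt h0 a : X.functionField) : X.Frac) * X.cls (MvPolynomial.X 0) =
      X.cls (∑ i, MvPolynomial.C (a i) * MvPolynomial.X i) := by
  have hhom : (∑ i, MvPolynomial.C (a i) * MvPolynomial.X i :
      MvPolynomial (Fin (n + 1)) K).IsHomogeneous 1 :=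
    MvPolynomial.IsHomogeneous.sum _ _ _ fun i _ => by
      simpa using (MvPolynomial.isHomogeneous_C _ (a i)).mul (MvPolynomial.isHomogeneous_X K i)
  rw [X.cls_eq_pow_mul_aeval_coordFun hhom, pow_one, mul_comm, coe_linearFormAt]
  simp [Algebra.smul_def]

lemma linearFormAt_ne_zero {P : ℙ K (Fin (n + 1) → K)} (h0 : P.rep 0 ≠ 0)
    {a : Fin (n + 1) → K} (ha : a ≠ 0) : X.linearFormAt h0 a ≠ 0 := by
  intro h
  have := X.linearFormAt_mul_cls h0 a
  rw [h] at this
  refine X.cls_linearForm_ne_zero ha (this.symm.trans ?_)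
  simp

lemma evalAt_linearFormAt {P : ℙ K (Fin (n + 1) → K)} (hP : P ∈ X.points) (h0 : P.rep 0 ≠ 0)
    (a : Fin (n + 1) → K) :
    X.evalAt hP (X.linearFormAt h0 a) = ∑ i, a i * (P.rep i / P.rep 0) := by
  simp only [linearFormAt, Fintype.linearCombination_apply, map_sum, map_smul, smul_eq_mul]
  exact Finset.sum_congr rfl fun i _ => by
    rw [HasValue.evalAt_eq hP (X.hasValue_coordFun h0 i)]

/-- The multiplicity does not depend on the choices in its definition: another `x_j` changes the
function by the unit `x_j / x_0`, and two local parameters are associated. -/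
lemma hasIntersectionMult_iff {P : ℙ K (Fin (n + 1) → K)} (hP : X.IsNonsingularAt P)
    (h0 : P.rep 0 ≠ 0) {ϖ : X.localRing P} (hϖ : Irreducible ϖ) (H : ℙ K (Fin (n + 1) → K))
    (m : ℕ) : X.HasIntersectionMult P H m ↔ Associated (X.linearFormAt h0 H.rep) (ϖ ^ m) := by
  have := hP.2
  constructor
  · rintro ⟨j, z, ϖ', hj, hz, hϖ', hass⟩
    have hval := X.hasValue_ratio (P := P) j h0
    let u : X.localRing P := ⟨X.ratio j 0, _, hval⟩
    have hu : IsUnit u := (X.isUnit_iff_evalAt_ne_zero hP.1 u).2 (by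
      rw [HasValue.evalAt_eq hP.1 hval]
      exact div_ne_zero hj h0)
    have heq : X.linearFormAt h0 H.rep = z * u := by
      apply Subtype.val_injective
      apply Subtype.val_injective
      apply mul_right_cancel₀ (X.cls_X_ne_zero 0)
      rw [linearFormAt_mul_cls, ← hz]
      change _ = ((z : X.functionField) : X.Frac) *
        (X.cls (MvPolynomial.X j) / X.cls (MvPolynomial.X 0)) * _
      rw [mul_assoc, div_mul_cancel₀ _ (X.cls_X_ne_zero 0)]
    rw [heq]
    exact ((associated_mul_unit_left z u hu).trans hass).trans
      ((IsDiscreteValuationRing.associated_of_irreducible _ hϖ' hϖ).pow_pow)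
  · exact fun h => ⟨0, _, ϖ, h0, X.linearFormAt_mul_cls h0 _, hϖ, h⟩

variable {X}

lemma linearFormAt_associated_pow_le {P : ℙ K (Fin (n + 1) → K)} (hP : X.IsNonsingularAt P)
    (h0 : P.rep 0 ≠ 0) {ϖ : X.localRing P} (hϖ : Irreducible ϖ) {E : ℕ}
    (hE : IsGreatest (X.orderSet P) E) {a : Fin (n + 1) → K} (ha : a ≠ 0) {m : ℕ}
    (h : ϖ ^ m ∣ X.linearFormAt h0 a) : m ≤ E := by
  have := hP.2
  obtain ⟨r, hr⟩ := IsDiscreteValuationRing.associated_pow_irreducible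
    (X.linearFormAt_ne_zero h0 ha) hϖ
  obtain ⟨c, hc⟩ := Projectivization.exists_smul_eq_mk_rep K a ha
  have hmem : r ∈ X.orderSet P := by
    refine ⟨Projectivization.mk K a ha, (X.hasIntersectionMult_iff hP h0 hϖ _ _).2 ?_⟩
    rw [← hc, Units.smul_def, map_smul, Algebra.smul_def, mul_comm]
    exact (associated_mul_unit_left _ _ ((c.isUnit).map (algebraMap K _))).trans hr
  exact ((pow_dvd_pow_iff hϖ.ne_zero hϖ.not_isUnit).1 (h.trans hr.dvd)).trans (hE.2 hmem)

/-- A hyperplane that meets `X` at `P` with multiplicity at least the last order is the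
osculating hyperplane. -/
lemma exists_smul_eq_of_pow_dvd_linearFormAt {P H : ℙ K (Fin (n + 1) → K)}
    (hP : X.IsNonsingularAt P) (h0 : P.rep 0 ≠ 0) {ϖ : X.localRing P} (hϖ : Irreducible ϖ) {E : ℕ}
    (hE : IsGreatest (X.orderSet P) E) (hH : X.HasIntersectionMult P H E)
    {a : Fin (n + 1) → K} (h : ϖ ^ E ∣ X.linearFormAt h0 a) :
    ∃ c : K, a = c • H.rep := by
  have := hP.2
  obtain ⟨u, hu⟩ := ((X.hasIntersectionMult_iff hP h0 hϖ H E).1 hH).symm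
  obtain ⟨w, hw⟩ := h
  have hu0 := (X.isUnit_iff_evalAt_ne_zero hP.1 u).1 u.isUnit
  -- This scalar cancels the leading terms `ϖ ^ E * w` and `ϖ ^ E * u`: a nonzero difference would
  -- vanish to order `E + 1`, beyond the maximal order.
  refine ⟨X.evalAt hP.1 w / X.evalAt hP.1 u, ?_⟩
  by_contra hne
  have hne' := sub_ne_zero.2 hne
  set c := X.evalAt hP.1 w / X.evalAt hP.1 u
  have hval : X.evalAt hP.1 (w - c • (u : X.localRing P)) = 0 := by
    simp [c, hu0]
  have hdvd : ϖ ∣ w - c • (u : X.localRing P) := by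
    rw [← Ideal.mem_span_singleton, ← hϖ.maximalIdeal_eq, IsLocalRing.mem_maximalIdeal,
      mem_nonunits_iff, X.isUnit_iff_evalAt_ne_zero hP.1]
    exact not_not.2 hval
  have hle : E + 1 ≤ E := by
    refine linearFormAt_associated_pow_le hP h0 hϖ hE hne' ?_
    rw [map_sub, map_smul, hw, ← hu, ← mul_smul_comm, ← mul_sub, pow_succ]
    exact mul_dvd_mul_left _ hdvd
  omega

/-! ### Hasse derivatives at a point -/

namespace IsHasseDeriv

variable {t : X.functionField} {D : ℕ → X.functionField →ₗ[K] X.functionField}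

/-- By induction, the Leibniz rule for `1 * 1` reads `x = x + x`, which forces `x = 0` in every
characteristic. -/
lemma map_one (hD : X.IsHasseDeriv t D) (m : ℕ) : D (m + 1) 1 = 0 := by
  induction m using Nat.strong_induction_on with
  | _ m ih =>
    have h := hD.leibniz (m + 1) 1 1
    rw [mul_one, Finset.Nat.sum_antidiagonal_succ, hD.zero,
      Finset.sum_eq_single (m, 0)] at h
    · simpa [hD.zero] using h
    · rintro ⟨i, j⟩ hij hne
      rw [Finset.HasAntidiagonal.mem_antidiagonal] at hij
      dsimp only at hij ⊢
      rw [ih i (lt_of_le_of_ne (by omega) fun hi => hne (by ext <;> dsimp only <;> omega)),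
        zero_mul]
    · simp

/-- Only the derivatives of order `0` and `1` of `t - c` survive in the Leibniz sum. -/
lemma map_shift_mul (hD : X.IsHasseDeriv t D) (c : K) (m : ℕ) (h : X.functionField) :
    D (m + 1) ((t - algebraMap K _ c) * h) = (t - algebraMap K _ c) * D (m + 1) h + D m h := by
  have hc : ∀ i, D (i + 1) (t - algebraMap K _ c) = D (i + 1) t := fun i => by
    rw [map_sub, Algebra.algebraMap_eq_smul_one, map_smul, hD.map_one, smul_zero, sub_zero]
  rw [hD.leibniz, Finset.Nat.sum_antidiagonal_succ, hD.zero, Finset.sum_eq_single (0, m)]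
  · simp [hc, hD.one_self]
  · rintro ⟨i, j⟩ hij hne
    rw [Finset.HasAntidiagonal.mem_antidiagonal] at hij
    dsimp only at hij ⊢
    have hi : i ≠ 0 := fun hi => hne (by ext <;> dsimp only <;> omega)
    rw [hc, hD.self _ (by omega), zero_mul]
  · simp

/-- The rational functions whose Hasse derivatives up to order `E` are regular at `P`. -/
def regularAt (hD : X.IsHasseDeriv t D) (E : ℕ) (P : ℙ K (Fin (n + 1) → K)) :
    Subalgebra K X.functionField where
  carrier := {z | ∀ i ≤ E, D i z ∈ X.localRing P}
  mul_mem' := by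
    intro z w hz hw i hi
    rw [hD.leibniz]
    refine sum_mem fun p hp => ?_
    rw [Finset.HasAntidiagonal.mem_antidiagonal] at hp
    exact mul_mem (hz _ (by omega)) (hw _ (by omega))
  add_mem' := by
    intro z w hz hw i hi
    rw [map_add]
    exact add_mem (hz i hi) (hw i hi)
  algebraMap_mem' := by
    intro c i hi
    rw [Algebra.algebraMap_eq_smul_one, map_smul]
    refine Subalgebra.smul_mem _ ?_ c
    cases i with
    | zero => simp [hD.zero]
    | succ i => simp [hD.map_one]

/-- A quotient rule: the Leibniz formula for `z * g` is solved for `D i z`, the other terms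
containing only lower derivatives of `z`. -/
lemma mem_regularAt_of_mul_mem (hD : X.IsHasseDeriv t D) {E : ℕ} {P : ℙ K (Fin (n + 1) → K)}
    {z g : X.functionField} (hg0 : g ≠ 0) (hginv : g⁻¹ ∈ X.localRing P)
    (hg : g ∈ hD.regularAt E P) (hzg : z * g ∈ hD.regularAt E P) : z ∈ hD.regularAt E P := by
  intro i
  induction i using Nat.strong_induction_on with
  | _ i ih =>
    intro hi
    have h := hD.leibniz i z g
    rw [← Finset.add_sum_erase _ _ (a := (i, 0))
      (Finset.HasAntidiagonal.mem_antidiagonal.2 (add_zero i)), hD.zero,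
      LinearMap.id_apply] at h
    have hDz : D i z = g⁻¹ * (D i (z * g) -
        ∑ p ∈ (Finset.HasAntidiagonal.antidiagonal i).erase (i, 0), D p.1 z * D p.2 g) := by
      rw [h, add_sub_cancel_right, mul_comm (D i z), inv_mul_cancel_left₀ hg0]
    rw [hDz]
    refine mul_mem hginv (sub_mem (hzg i hi) (sum_mem fun p hp => ?_))
    obtain ⟨hne, hp⟩ := Finset.mem_erase.1 hp
    rw [Finset.HasAntidiagonal.mem_antidiagonal] at hp
    refine mul_mem (ih _ (lt_of_le_of_ne (by omega) fun h => hne ?_) (by omega))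
      (hg _ (by omega))
    ext <;> dsimp only <;> omega

/-- Dehomogenizing writes a regular function as a quotient of polynomials in the `X.coordFun j`
whose denominator does not vanish at `P`, so finitely many conditions control the whole local ring.
-/
lemma localRing_le_regularAt (hD : X.IsHasseDeriv t D) {E : ℕ} {P : ℙ K (Fin (n + 1) → K)}
    (hP : P ∈ X.points) (h0 : P.rep 0 ≠ 0)
    (hreg : ∀ i ≤ E, ∀ j, D i (X.coordFun j) ∈ X.localRing P) :
    X.localRing P ≤ hD.regularAt E P := by
  have hpoly : ∀ f : MvPolynomial (Fin (n + 1)) K,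
      MvPolynomial.aeval X.coordFun f ∈ hD.regularAt E P := by
    intro f
    have hle : Algebra.adjoin K (Set.range X.coordFun) ≤ hD.regularAt E P :=
      Algebra.adjoin_le (by rintro _ ⟨j, rfl⟩ i hi; exact hreg i hi j)
    apply hle
    rw [Algebra.adjoin_range_eq_range_aeval]
    exact ⟨f, rfl⟩
  rintro z ⟨c, d, f, g, hf, hg, hg0, hzg, -⟩
  have hX0 : X.cls (MvPolynomial.X 0) ^ d ≠ 0 := pow_ne_zero d (X.cls_X_ne_zero 0)
  have hmul : z * MvPolynomial.aeval X.coordFun g = MvPolynomial.aeval X.coordFun f := by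
    apply Subtype.val_injective
    apply mul_left_cancel₀ hX0
    rw [X.cls_eq_pow_mul_aeval_coordFun hf, X.cls_eq_pow_mul_aeval_coordFun hg] at hzg
    rw [← hzg, MulMemClass.coe_mul]
    ring
  have hval : X.HasValue P (MvPolynomial.aeval X.coordFun g)
      (MvPolynomial.eval P.rep g / P.rep 0 ^ d) := by
    refine ⟨d, g, MvPolynomial.X 0 ^ d, hg, ?_, ?_, ?_, ?_⟩
    · simpa using (MvPolynomial.isHomogeneous_X K (0 : Fin (n + 1))).pow d
    · simpa using fun h => absurd h h0
    · rw [X.cls_eq_pow_mul_aeval_coordFun hg, mul_comm]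
      simp [cls]
    · simp [div_mul_cancel₀ _ (pow_ne_zero d h0)]
  have hv0 : MvPolynomial.eval P.rep g / P.rep 0 ^ d ≠ 0 := div_ne_zero hg0 (pow_ne_zero d h0)
  refine hD.mem_regularAt_of_mul_mem ?_ ⟨_, hval.inv hP hv0⟩ (hpoly g) (hmul ▸ hpoly f)
  intro h
  rw [h] at hval
  exact hv0 (hval.unique hP (by simpa using X.hasValue_algebraMap P 0))

/-- The `i`-th Hasse derivative on the local ring at `P`. -/
def derivAt (hD : X.IsHasseDeriv t D) {E : ℕ} {P : ℙ K (Fin (n + 1) → K)}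
    (hreg : X.localRing P ≤ hD.regularAt E P) (i : ℕ) (hi : i ≤ E) (z : X.localRing P) :
    X.localRing P :=
  ⟨D i z, hreg z.2 i hi⟩

variable {E : ℕ} {P : ℙ K (Fin (n + 1) → K)}

lemma derivAt_shift_mul (hD : X.IsHasseDeriv t D) (hreg : X.localRing P ≤ hD.regularAt E P)
    (ht : t ∈ X.localRing P) (c : K) {m : ℕ} (hm : m + 1 ≤ E) (h : X.localRing P) :
    hD.derivAt hreg (m + 1) hm ((⟨t, ht⟩ - algebraMap K _ c) * h) =
      (⟨t, ht⟩ - algebraMap K _ c) * hD.derivAt hreg (m + 1) hm h +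
        hD.derivAt hreg m (by omega) h :=
  Subtype.ext (hD.map_shift_mul c m h)

lemma derivAt_one_mul (hD : X.IsHasseDeriv t D) (hreg : X.localRing P ≤ hD.regularAt E P)
    (hE : 1 ≤ E) (z w : X.localRing P) :
    hD.derivAt hreg 1 hE (z * w) =
      z * hD.derivAt hreg 1 hE w + hD.derivAt hreg 1 hE z * w := by
  apply Subtype.val_injective
  change D 1 ((z : X.functionField) * w) = z * D 1 w + D 1 z * w
  rw [hD.leibniz, Finset.Nat.sum_antidiagonal_succ, hD.zero]
  simp [hD.zero]

lemma derivAt_one_shift (hD : X.IsHasseDeriv t D) (hreg : X.localRing P ≤ hD.regularAt E P)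
    (ht : t ∈ X.localRing P) (c : K) (hE : 1 ≤ E) :
    hD.derivAt hreg 1 hE (⟨t, ht⟩ - algebraMap K _ c) = 1 := by
  apply Subtype.val_injective
  change D 1 (t - algebraMap K _ c) = 1
  rw [map_sub, Algebra.algebraMap_eq_smul_one, map_smul, hD.map_one, smul_zero, sub_zero,
    hD.one_self]

/-- If `t` and the first Hasse derivative are regular at `P`, then `t - t(P)` is a local
parameter at `P`. -/
lemma shift_associated (hD : X.IsHasseDeriv t D) (hE : 1 ≤ E) (hP : X.IsNonsingularAt P)
    (hreg : X.localRing P ≤ hD.regularAt E P) (ht : t ∈ X.localRing P)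
    {ϖ : X.localRing P} (hϖ : Irreducible ϖ) {c : K}
    (hc : X.evalAt hP.1 (⟨t, ht⟩ - algebraMap K _ c) = 0) :
    Associated (⟨t, ht⟩ - algebraMap K _ c) ϖ := by
  have := hP.2
  have hϖ0 : X.evalAt hP.1 ϖ = 0 := by
    by_contra h
    exact hϖ.not_isUnit ((X.isUnit_iff_evalAt_ne_zero hP.1 ϖ).2 h)
  have hmem : ⟨t, ht⟩ - algebraMap K _ c ∈ IsLocalRing.maximalIdeal (X.localRing P) := by
    rw [IsLocalRing.mem_maximalIdeal, mem_nonunits_iff, X.isUnit_iff_evalAt_ne_zero hP.1]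
    exact not_not.2 hc
  rw [hϖ.maximalIdeal_eq, Ideal.mem_span_singleton] at hmem
  obtain ⟨h, hh⟩ := hmem
  -- Differentiating `t - c = ϖ * h` and evaluating at `P` gives `1 = (D 1 ϖ)(P) * h(P)`, so `h` is
  -- a unit.
  have hone := hD.derivAt_one_shift hreg ht c hE
  rw [hh, derivAt_one_mul] at hone
  have hev := congrArg (X.evalAt hP.1) hone
  rw [_root_.map_one, map_add, map_mul, map_mul, hϖ0, zero_mul, zero_add] at hev
  have hunit : IsUnit h := (X.isUnit_iff_evalAt_ne_zero hP.1 h).2 fun h0 => by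
    rw [h0, mul_zero] at hev
    exact zero_ne_one hev
  rw [hh]
  exact associated_mul_unit_left ϖ h hunit

/-- Each factor `t - c` lowers the order of the derivative by one, up to a multiple of `t - c`,
which vanishes at `P`. -/
lemma evalAt_derivAt_shift_pow_mul (hD : X.IsHasseDeriv t D) (hP : P ∈ X.points)
    (hreg : X.localRing P ≤ hD.regularAt E P) (ht : t ∈ X.localRing P) {c : K}
    (hc : X.evalAt hP (⟨t, ht⟩ - algebraMap K _ c) = 0) (h : X.localRing P) {r : ℕ} (hr : r ≤ E) :
    X.evalAt hP (hD.derivAt hreg r hr ((⟨t, ht⟩ - algebraMap K _ c) ^ r * h)) =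
      X.evalAt hP h := by
  induction r with
  | zero =>
    rw [pow_zero, one_mul]
    congr 1
    exact Subtype.ext (LinearMap.congr_fun hD.zero (h : X.functionField))
  | succ r ih =>
    rw [pow_succ', mul_assoc, derivAt_shift_mul, map_add, map_mul, hc, zero_mul, zero_add]
    exact ih _

/-- A regular function all of whose Hasse derivatives of order less than `E` vanish at `P` vanishes
at `P` to order at least `E`. -/
lemma pow_dvd_of_hasValue_zero (hD : X.IsHasseDeriv t D) (hE : 1 ≤ E)
    (hP : X.IsNonsingularAt P) (hreg : X.localRing P ≤ hD.regularAt E P) (ht : t ∈ X.localRing P)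
    {ϖ : X.localRing P} (hϖ : Irreducible ϖ) {f : X.localRing P}
    (hf : ∀ m < E, X.HasValue P (D m f) 0) : ϖ ^ E ∣ f := by
  have := hP.2
  rcases eq_or_ne f 0 with rfl | hf0
  · exact dvd_zero _
  obtain ⟨r, hr⟩ := IsDiscreteValuationRing.associated_pow_irreducible hf0 hϖ
  rcases le_or_gt E r with hEr | hrE
  · exact (pow_dvd_pow ϖ hEr).trans hr.symm.dvd
  -- With `f = (t - c) ^ r * u`, `u` a unit and `r < E`, the value of `D r f` at `P` is `u(P) ≠ 0`.
  exfalso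
  have hc : X.evalAt hP.1 (⟨t, ht⟩ - algebraMap K _ (X.evalAt hP.1 ⟨t, ht⟩)) = 0 := by
    rw [map_sub, AlgHom.commutes, Algebra.algebraMap_self_apply, sub_self]
  have hτ := hD.shift_associated hE hP hreg ht hϖ hc
  obtain ⟨u, hu⟩ := (hr.trans (hτ.symm.pow_pow)).symm
  have hval := hD.evalAt_derivAt_shift_pow_mul hP.1 hreg ht hc u hrE.le
  rw [hu] at hval
  have hzero : X.evalAt hP.1 (hD.derivAt hreg r hrE.le f) = 0 := HasValue.evalAt_eq hP.1 (hf r hrE)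
  exact (X.isUnit_iff_evalAt_ne_zero hP.1 u).1 u.isUnit (hval.symm.trans hzero)

end IsHasseDeriv

end ProjVariety

/-- Take the cofactors of row `r`: their pairing with `v` is the determinant with row `r` replaced
by `v`. Pairing with row `r` itself gives `det M ≠ 0`, so they are not all zero. -/
lemma Matrix.exists_ne_zero_cofactor_relation {m F : Type*} [Fintype m] [DecidableEq m] [Field F]
    (M : Matrix m m F) (hM : M.det ≠ 0) (r : m) :
    ∃ a : m → F, a ≠ 0 ∧ (∀ i, i ≠ r → ∑ j, a j * M i j = 0) ∧
      ∀ v : m → F, (M.updateRow r v).det = 0 → ∑ j, a j * v j = 0 := by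
  have hmul : ∀ i, ∑ j, M.adjugate j r * M i j = if i = r then M.det else 0 := by
    intro i
    have h := congrFun (congrFun M.mul_adjugate i) r
    simp only [Matrix.mul_apply, Matrix.smul_apply, Matrix.one_apply, smul_eq_mul, mul_ite,
      mul_one, mul_zero] at h
    rw [← h]
    exact Finset.sum_congr rfl fun j _ => mul_comm _ _
  refine ⟨fun j => M.adjugate j r, fun h0 => hM ?_, fun i hi => ?_, fun v hv => ?_⟩
  · rw [← (hmul r).trans (if_pos rfl)]
    refine Finset.sum_eq_zero fun j _ => ?_
    rw [show M.adjugate j r = 0 from congrFun h0 j, zero_mul]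
  · exact (hmul i).trans (if_neg hi)
  · rwa [← Matrix.cramer_transpose_apply, Matrix.cramer_eq_adjugate_mulVec,
      ← Matrix.adjugate_transpose] at hv

namespace ProjVariety

variable {k K : Type*} [Field k] [Field K] [Algebra k K] {n : ℕ} {X : ProjVariety k K n}

/-! ### The strict Gauss map and the Frobenius map -/

lemma isGreatest_orderSet {ε : Fin (n + 1) → ℕ} {P : ℙ K (Fin (n + 1) → K)}
    (hP : P ∈ X.openLocus ε) : IsGreatest (X.orderSet P) (ε (Fin.last n)) := by
  rw [← hP.2.2]
  refine ⟨⟨_, rfl⟩, ?_⟩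
  rintro _ ⟨i, rfl⟩
  exact hP.2.1.monotone (Fin.le_last i)

lemma hasIntersectionMult_gaussMap {ε : Fin (n + 1) → ℕ} {P : ℙ K (Fin (n + 1) → K)}
    (hP : P ∈ X.openLocus ε) : X.HasIntersectionMult P (X.gaussMap P) (ε (Fin.last n)) := by
  have hgr := isGreatest_orderSet hP
  obtain ⟨H, hH⟩ := hgr.1
  obtain ⟨m, hm, hmult⟩ := Classical.epsilon_spec (p := X.IsOsculating P) ⟨H, _, hgr, hH⟩
  rwa [hm.unique hgr] at hmult

lemma last_order_pos {ε : Fin (n + 1) → ℕ} {P : ℙ K (Fin (n + 1) → K)} (hn : 1 ≤ n)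
    (hP : P ∈ X.openLocus ε) : 1 ≤ ε (Fin.last n) :=
  Nat.one_le_iff_ne_zero.2 (hP.2.1 (show (0 : Fin (n + 1)) < Fin.last n from hn)).ne_bot

lemma gaussMap_incident {ε : Fin (n + 1) → ℕ} {P : ℙ K (Fin (n + 1) → K)} (hn : 1 ≤ n)
    (hP : P ∈ X.openLocus ε) (h0 : P.rep 0 ≠ 0) :
    ∑ j, (X.gaussMap P).rep j * P.rep j = 0 := by
  have := hP.1.2
  obtain ⟨ϖ, hϖ⟩ := IsDiscreteValuationRing.exists_irreducible (X.localRing P)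
  have hass := (X.hasIntersectionMult_iff hP.1 h0 hϖ _ _).1 (hasIntersectionMult_gaussMap hP)
  have hval : X.evalAt hP.1.1 (X.linearFormAt h0 (X.gaussMap P).rep) = 0 := by
    by_contra h
    have hunit := hass.isUnit ((X.isUnit_iff_evalAt_ne_zero hP.1.1 _).2 h)
    exact hϖ.not_isUnit ((isUnit_pow_iff (Nat.one_le_iff_ne_zero.1 (last_order_pos hn hP))).1 hunit)
  rw [evalAt_linearFormAt] at hval
  simp only [← mul_div_assoc, ← Finset.sum_div] at hval
  exact (div_eq_zero_iff.1 hval).resolve_right h0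

/-- The cofactors of a row of the Frobenius matrix give a relation between the Frobenius
image and the Hasse derivatives of lower order. -/
lemma IsFrobeniusOrderSeq.exists_relation {N : ℕ} {ν : Fin n → ℕ}
    (hν : X.IsFrobeniusOrderSeq N ν) (r : Fin n) :
    ∃ (t : X.functionField) (D : ℕ → X.functionField →ₗ[K] X.functionField)
      (a : Fin (n + 1) → X.functionField), X.IsHasseDeriv t D ∧ a ≠ 0 ∧
      ∑ j, a j * X.coordFun j ^ N = 0 ∧
      ∀ m < ν r, ∑ j, a j * D m (X.coordFun j) = 0 := by
  obtain ⟨t, D, -, hD, hdet, hmin⟩ := hν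
  obtain ⟨a, ha0, hrow, hupdate⟩ :=
    (X.frobeniusMatrix D N ν).exists_ne_zero_cofactor_relation hdet r.succ
  refine ⟨t, D, a, hD, ha0, hrow 0 (Fin.succ_ne_zero r).symm, fun m hm => hupdate _ ?_⟩
  have hupd : X.frobeniusMatrix D N (Function.update ν r m) =
      (X.frobeniusMatrix D N ν).updateRow r.succ (fun j => D m (X.coordFun j)) := by
    ext i j
    refine Fin.cases ?_ (fun i => ?_) i
    · rw [Matrix.updateRow_ne (Fin.succ_ne_zero r).symm]
      rfl
    · rcases eq_or_ne i r with rfl | hi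
      · rw [Matrix.updateRow_self]
        simp only [frobeniusMatrix, Matrix.of_apply, Fin.cons_succ, Function.update_self]
      · rw [Matrix.updateRow_ne (fun h => hi (Fin.succ_injective n h))]
        simp only [frobeniusMatrix, Matrix.of_apply, Fin.cons_succ, Function.update_of_ne hi]
  rw [← hupd]
  -- Lowering the entry `ν r` to `m` gives a lexicographically smaller sequence, contradicting
  -- minimality.
  by_contra h
  exact absurd (hmin _ h) (not_le.2 (Pi.toLex_update_lt_self_iff.2 hm))

lemma eventually_mem_localRing (hX : X.IsCurve) (z : X.functionField) :
    ∀ᶠ P in Filter.cofinite, P ∈ X.points → z ∈ X.localRing P := by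
  simpa [Filter.eventually_cofinite] using X.finite_poles hX z

lemma eventually_not_hasValue_zero (hX : X.IsCurve) {z : X.functionField} (hz : z ≠ 0) :
    ∀ᶠ P in Filter.cofinite, P ∈ X.points → ¬ X.HasValue P z 0 := by
  simpa [Filter.eventually_cofinite] using X.finite_zeros hX hz

lemma eventually_rep_ne_zero (hX : X.IsCurve) (j : Fin (n + 1)) :
    ∀ᶠ P in Filter.cofinite, P ∈ X.points → P.rep j ≠ 0 := by
  simpa [Filter.eventually_cofinite] using X.finite_rep_eq_zero hX j

/-- If a term of the `𝔽_N`-Frobenius order sequence equals the last order, then the osculating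
hyperplane at a general point contains the Frobenius image of the point. -/
lemma eventually_frobenius_incident (hX : X.IsCurve) (hn : 1 ≤ n) {ε : Fin (n + 1) → ℕ} {N : ℕ}
    {ν : Fin n → ℕ} (hν : X.IsFrobeniusOrderSeq N ν) {r : Fin n} (hr : ν r = ε (Fin.last n)) :
    ∀ᶠ P in Filter.cofinite, P ∈ X.openLocus ε →
      ∑ j, (X.gaussMap P).rep j * P.rep j ^ N = 0 := by
  obtain ⟨t, D, a, hD, ha0, haN, haD⟩ := hν.exists_relation r
  rw [hr] at haD
  obtain ⟨j₀, hj₀⟩ := Function.ne_iff.1 ha0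
  -- Each condition excludes finitely many points, and there are finitely many conditions because
  -- only derivatives up to order `ε_n` are needed.
  filter_upwards [eventually_rep_ne_zero hX 0, eventually_mem_localRing hX t,
    Filter.eventually_all.2 fun j => eventually_mem_localRing hX (a j),
    eventually_not_hasValue_zero hX hj₀,
    Filter.eventually_all.2 fun p : Fin (ε (Fin.last n) + 1) × Fin (n + 1) =>
      eventually_mem_localRing hX (D p.1 (X.coordFun p.2))] with P h0 ht ha haj hder hP
  have hpt := hP.1.1
  have := hP.1.2
  replace h0 := h0 hpt
  have hder' : ∀ i ≤ ε (Fin.last n), ∀ j, D i (X.coordFun j) ∈ X.localRing P := fun i hi j =>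
    hder (⟨i, Nat.lt_succ_of_le hi⟩, j) hpt
  let A (j : Fin (n + 1)) : X.localRing P := ⟨a j, ha j hpt⟩
  let b (j : Fin (n + 1)) : K := X.evalAt hpt (A j)
  have hb0 : b j₀ ≠ 0 := by
    intro h
    have hval := X.hasValue_evalAt hpt (A j₀)
    rw [show X.evalAt hpt (A j₀) = 0 from h] at hval
    exact haj hpt hval
  obtain ⟨ϖ, hϖ⟩ := IsDiscreteValuationRing.exists_irreducible (X.localRing P)
  -- The `a j` stand outside the derivatives in the relations, so freezing them at their values `b
  -- j` gives the vanishing at `P` of the derivatives of a constant-coefficient linear form.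
  have hdvd : ϖ ^ ε (Fin.last n) ∣ X.linearFormAt h0 b := by
    refine hD.pow_dvd_of_hasValue_zero (last_order_pos hn hP) hP.1
      (hD.localRing_le_regularAt hpt h0 hder') (ht hpt) hϖ fun m hm => ?_
    let d (j : Fin (n + 1)) : X.localRing P := ⟨D m (X.coordFun j), hder' m hm.le j⟩
    have hrel : ∑ j, A j * d j = 0 := Subtype.ext (by simpa [A, d] using haD m hm)
    have hval : X.evalAt hpt (∑ j, b j • d j) = 0 := by
      rw [← map_zero (X.evalAt hpt), ← hrel]
      simp only [map_sum, map_smul, map_mul, smul_eq_mul, b]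
    have hcoe : ((∑ j, b j • d j : X.localRing P) : X.functionField) =
        D m (X.linearFormAt h0 b) := by
      rw [coe_linearFormAt]
      simp [d]
    rw [← hcoe, ← hval]
    exact X.hasValue_evalAt hpt _
  obtain ⟨c, hc⟩ := exists_smul_eq_of_pow_dvd_linearFormAt hP.1 h0 hϖ (isGreatest_orderSet hP)
    (hasIntersectionMult_gaussMap hP) hdvd
  have hc0 : c ≠ 0 := by
    rintro rfl
    exact hb0 (by simpa using congrFun hc j₀)
  let x (j : Fin (n + 1)) : X.localRing P := ⟨X.coordFun j, _, X.hasValue_coordFun h0 j⟩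
  have hx : ∀ j, X.evalAt hpt (x j) = P.rep j / P.rep 0 := fun j =>
    HasValue.evalAt_eq hpt (X.hasValue_coordFun h0 j)
  have hrel : ∑ j, A j * x j ^ N = 0 := Subtype.ext (by simpa [A, x] using haN)
  have hev := congrArg (X.evalAt hpt) hrel
  simp only [map_sum, map_mul, map_pow, hx, map_zero] at hev
  have hev' : c / P.rep 0 ^ N * ∑ j, (X.gaussMap P).rep j * P.rep j ^ N = 0 := by
    rw [← hev, Finset.mul_sum]
    refine Finset.sum_congr rfl fun j _ => ?_
    rw [show X.evalAt hpt (A j) = c * (X.gaussMap P).rep j from congrFun hc j, div_pow]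
    ring
  exact (mul_eq_zero.1 hev').resolve_left (div_ne_zero hc0 (pow_ne_zero _ h0))

/-- Every point of the fibre lies on its own osculating hyperplane `H`, and a hyperplane meets the
curve in finitely many points. -/
lemma finite_gaussMap_fiber (hX : X.IsCurve) (hn : 1 ≤ n) (ε : Fin (n + 1) → ℕ)
    (H : ℙ K (Fin (n + 1) → K)) : {P | P ∈ X.openLocus ε ∧ X.gaussMap P = H}.Finite := by
  let z : X.functionField := ∑ i, H.rep i • X.coordFun i
  have hsub : ∀ P ∈ {P | P ∈ X.openLocus ε ∧ X.gaussMap P = H}, P.rep 0 ≠ 0 →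
      z ≠ 0 ∧ X.HasValue P z 0 := by
    rintro P ⟨hP, rfl⟩ h0
    have hz := X.coe_linearFormAt h0 (X.gaussMap P).rep
    refine ⟨fun h => X.linearFormAt_ne_zero h0 (X.gaussMap P).rep_nonzero
      (Subtype.ext (hz.trans h)), ?_⟩
    have hval := X.hasValue_evalAt hP.1.1 (X.linearFormAt h0 (X.gaussMap P).rep)
    rw [evalAt_linearFormAt, hz] at hval
    simp only [← mul_div_assoc, ← Finset.sum_div] at hval
    rwa [gaussMap_incident hn hP h0, zero_div] at hval
  by_cases hz : z = 0
  · refine (X.finite_rep_eq_zero hX 0).subset fun P hP => ⟨hP.1.1.1, ?_⟩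
    by_contra h0
    exact (hsub P hP h0).1 hz
  · refine ((X.finite_rep_eq_zero hX 0).union (X.finite_zeros hX hz)).subset fun P hP => ?_
    by_cases h0 : P.rep 0 = 0
    · exact Or.inl ⟨hP.1.1.1, h0⟩
    · exact Or.inr ⟨hP.1.1.1, (hsub P hP h0).2⟩

end ProjVariety

/-! ### Hyperplanes and their Frobenius conjugates -/

/-- Normalized coordinates of such a hyperplane are roots of `X ^ q - X`. These are the hyperplanes
for which `H' = H` in the final argument. -/
lemma finite_frobenius_fixed {K : Type*} [Field K] {n q : ℕ} (hq : 1 < q) :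
    {H : ℙ K (Fin (n + 1) → K) | ∃ j, H.rep j ≠ 0 ∧
      ∀ i, (H.rep i / H.rep j) ^ q = H.rep i / H.rep j}.Finite := by
  have hsub : {H : ℙ K (Fin (n + 1) → K) | ∃ j, H.rep j ≠ 0 ∧
      ∀ i, (H.rep i / H.rep j) ^ q = H.rep i / H.rep j} = ⋃ j, {H | H.rep j ≠ 0 ∧
      ∀ i, (H.rep i / H.rep j) ^ q = H.rep i / H.rep j} := by
    ext H
    simp
  rw [hsub]
  refine Set.finite_iUnion fun j => Set.Finite.of_injOn
    (t := Set.pi Set.univ fun _ => {c : K | c ^ q = c}) (f := fun H i => H.rep i / H.rep j)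
    ?_ ?_ (Set.Finite.pi fun i => ?_)
  · rintro H ⟨-, h⟩ i -
    exact h i
  · rintro P ⟨hj, -⟩ Q ⟨hj', -⟩ h
    exact ProjVariety.eq_of_rep_div_eq hj hj' (congrFun h)
  · refine (Polynomial.finite_setOfPred_isRoot
      (FiniteField.X_pow_card_sub_X_ne_zero K hq)).subset fun c hc => ?_
    simpa [sub_eq_zero] using hc

/-- Two distinct hyperplanes of `ℙⁿ` meet in a linear subspace of dimension `n - 2`. -/
lemma liesInLinearSubspace_of_linearIndependent {K : Type*} [Field K] {n : ℕ} (hn : 2 ≤ n)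
    {a b : Fin (n + 1) → K} (hab : LinearIndependent K ![a, b])
    {S : Set (ℙ K (Fin (n + 1) → K))}
    (hS : ∀ R ∈ S, ∃ (v : Fin (n + 1) → K) (hv : v ≠ 0), R = Projectivization.mk K v hv ∧
      ∑ i, a i * v i = 0 ∧ ∑ i, b i * v i = 0) : LiesInLinearSubspace S (n - 2) := by
  let M : Matrix (Fin 2) (Fin (n + 1)) K := Matrix.of ![a, b]
  refine ⟨LinearMap.ker M.mulVecLin, ?_, fun R hR => ?_⟩
  · have hrank : M.rank = 2 := by
      have := LinearIndependent.rank_matrix (M := M) hab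
      simpa using this
    have h := M.mulVecLin.finrank_range_add_finrank_ker
    rw [← Matrix.rank, hrank, Module.finrank_fin_fun] at h
    omega
  · obtain ⟨v, hv, rfl, h1, h2⟩ := hS R hR
    rw [Projectivization.submodule_mk, Submodule.span_singleton_le_iff_mem, LinearMap.mem_ker]
    funext i
    fin_cases i
    · simpa [M, Matrix.mulVec, dotProduct] using h1
    · simpa [M, Matrix.mulVec, dotProduct] using h2

end

/- Both `S(P) ⊆ H` and `Φ_q(S(P)) ⊆ H` hold for `H = γ(P)`, so that `S(P)` lies in the intersection of
`H` with its conjugate under the inverse of `Φ_q`, which is another hyperplane unless `H` is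
`𝔽_q`-rational. The lower bound on the separable degree only ensures that `S(P)` has enough points
for this to be informative; the proof does not need it. -/
theorem mainTheorem1 {k K : Type*} [Field k] [Finite k] [Field K] [Algebra k K]
    [IsAlgClosure k K] {n : ℕ} (X : ProjVariety k K n) (hX : X.IsCurve)
    (ε : Fin (n + 1) → ℕ) (hε : X.IsOrderSeq ε)
    (ℓ : ℕ) (hℓ : 1 ≤ ℓ) (hℓn : ℓ < n)
    (ν : ℕ → Fin n → ℕ)
    (hν : ∀ i, 1 ≤ i → i ≤ ℓ → X.IsFrobeniusOrderSeq (Nat.card k ^ i) (ν i))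
    (hnonclassical : ∀ i, 1 ≤ i → i ≤ ℓ → ν i ≠ fun j : Fin n => (j : ℕ))
    (hlast : ∀ i, 1 ≤ i → i ≤ ℓ → ν i ⟨n - 1, by omega⟩ = ε (Fin.last n))
    (hdeg : ⌈(n : ℚ) / (ℓ : ℚ) - 1⌉ < (X.gaussSepDegree ε : ℤ)) :
    {P | P ∈ X.openLocus ε ∧
      ¬ LiesInLinearSubspace (X.conjSet ε (Nat.card k) ℓ P) (n - 2)}.Finite := by
  have : IsAlgClosed K := IsAlgClosure.isAlgClosed k
  have := Fintype.ofFinite k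
  set q := Nat.card k with hq
  have hq1 : 1 < q := Finite.one_lt_card
  obtain ⟨p, hp⟩ := CharP.exists k
  obtain ⟨e, hprime, hcard⟩ := FiniteField.card k p
  have hfact : Fact p.Prime := ⟨hprime⟩
  have : CharP K p := charP_of_injective_algebraMap (algebraMap k K).injective p
  have hqe : q = p ^ (e : ℕ) := by rw [hq, Nat.card_eq_fintype_card, hcard]
  have hn : 1 ≤ n := by omega
  have hinc : ∀ᶠ P in Filter.cofinite, P ∈ X.openLocus ε → ∀ i : Fin (ℓ + 1),
      ∑ j, (X.gaussMap P).rep j * P.rep j ^ q ^ (i : ℕ) = 0 := by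
    have hev : ∀ i : Fin (ℓ + 1), ∀ᶠ P in Filter.cofinite, P ∈ X.openLocus ε →
        ∑ j, (X.gaussMap P).rep j * P.rep j ^ q ^ (i : ℕ) = 0 := by
      rintro ⟨i, hi⟩
      rcases Nat.eq_zero_or_pos i with rfl | hi0
      · filter_upwards [ProjVariety.eventually_rep_ne_zero hX 0] with P h0 hP
        simpa using ProjVariety.gaussMap_incident hn hP (h0 hP.1.1)
      · exact ProjVariety.eventually_frobenius_incident hX hn (hν i hi0 (by omega))
          (hlast i hi0 (by omega))
    filter_upwards [Filter.eventually_all.2 hev] with P h hP i using h i hP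
  rw [Filter.eventually_cofinite] at hinc
  -- Entire fibres are discarded, since `S(P)` involves every point with the same image as `P`.
  refine (((hinc.image X.gaussMap).union (finite_frobenius_fixed hq1)).biUnion fun H _ =>
    ProjVariety.finite_gaussMap_fiber hX hn ε H).subset ?_
  rintro P ⟨hP, hnot⟩
  refine Set.mem_iUnion₂.2 ⟨X.gaussMap P, ?_, hP, rfl⟩
  by_contra hcon
  rw [Set.mem_union, not_or] at hcon
  obtain ⟨hgood, hfixed⟩ := hcon
  refine hnot ?_
  set h := (X.gaussMap P).rep with hh
  have h_ne : h ≠ 0 := (X.gaussMap P).rep_nonzero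
  -- The hyperplane `h'` is the preimage of `h` under `Φ_q`.
  choose h' hh' using fun i => IsAlgClosed.exists_pow_nat_eq (h i) (zero_lt_one.trans hq1)
  have hind : LinearIndependent K ![h, h'] := by
    rw [LinearIndependent.pair_iff' h_ne]
    intro c hc
    obtain ⟨j, hj⟩ := Function.ne_iff.1 h_ne
    refine hfixed ⟨j, hj, fun i => ?_⟩
    -- If `h' = c • h`, taking `q`-th powers shows that the ratios `h i / h j` are fixed by `x ↦ x ^
    -- q`.
    have hpow : ∀ i, h i = c ^ q * h i ^ q := fun i => by
      have hi : c * h i = h' i := congrFun hc i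
      rw [← mul_pow, hi, hh' i]
    have hcj : c ^ q ≠ 0 := fun h0 => hj (by rw [hpow j, h0, zero_mul]; rfl)
    rw [div_pow, ← mul_div_mul_left _ _ hcj, ← hpow, ← hpow]
  refine liesInLinearSubspace_of_linearIndependent (by omega) hind ?_
  rintro R ⟨Q, hQ, hQP, r, hr, rfl⟩
  refine ⟨_, _, rfl, ?_, ?_⟩
  all_goals
    have hQinc : ∀ i : Fin (ℓ + 1), ∑ j, h j * Q.rep j ^ q ^ (i : ℕ) = 0 := by
      by_contra hbad
      refine hgood ⟨Q, fun hQ' => hbad ?_, hQP⟩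
      rw [hh, ← hQP]
      exact hQ' hQ
  · exact hQinc ⟨r, by omega⟩
  -- The `q`-th power is additive, so this is the incidence with exponent `q ^ (r + 1)`, available
  -- since `r + 1 ≤ ℓ`.
  · have hsum : (∑ i, h' i * Q.rep i ^ q ^ r) ^ q = 0 := by
      rw [hqe, sum_pow_char_pow, ← hqe, ← hQinc ⟨r + 1, by omega⟩]
      refine Finset.sum_congr rfl fun i _ => ?_
      rw [mul_pow, hh', ← pow_mul, pow_succ]
    exact eq_zero_of_pow_eq_zero hsum
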